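/- Let $\kappa$ be a regular uncountable cardinal. For a cardinal $\lambda\ge\kappa$ let $P_\kappa(\lambda)=\{a\subseteq\lambda:|a|<\kappa\}$, and call $C\subseteq P_\kappa(\lambda)$ closed unbounded if every $b\in P_\kappa(\lambda)$ is contained in some $a\in C$ and the union of every nonempty $\subseteq$-chain of fewer than $\kappa$ members of $C$ belongs to $C$. Let $NS_{\kappa,\lambda}$ be the collection of nonstationary subsets of $P_\kappa(\lambda)$, i.e. of those disjoint from some closed unbounded set, and let $NS_{\kappa,\lambda}^*=\{A\subseteq P_\kappa(\lambda):P_\kappa(\lambda)\setminus A\in NS_{\kappa,\lambda}\}$. An ideal on $P_\kappa(\lambda)$ is a collection $J$ of subsets of $P_\kappa(\lambda)$ that contains every $A\subseteq P_\kappa(\lambda)$ for which some $b\in P_\kappa(\lambda)$ is contained in no $a\in A$, does not contain $P_\kappa(\lambda)$ itself, and is closed under subsets and under unions of fewer than $\kappa$ of its members. For an infinite cardinal $\mu\le\lambda$, an ideal $J$ is $\mu$-normal if for every $A\subseteq P_\kappa(\lambda)$ with $A\notin J$ and every $f:A\to\mu$ with $f(a)\in a$ for all $a\in A$, there is $B\subseteq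 A$ with $B\notin J$ on which $f$ is constant. Let $NS^\mu_{\kappa,\lambda}$ be the smallest $\mu$-normal ideal on $P_\kappa(\lambda)$. For a collection $J$ of subsets of $P_\kappa(\lambda)$ and $A\subseteq P_\kappa(\lambda)$ let $J|A=\{B\subseteq P_\kappa(\lambda):B\cap A\in J\}$, and let $\overline{\mathrm{cof}}(J)$ be the least cardinality of a $Y\subseteq J$ such that every $A\in J$ is covered by the union of fewer than $\kappa$ members of $Y$. Finally, let $\chi^{+\kappa}$ be the $\kappa$-th cardinal after $\chi$, i.e. $\chi^{+\kappa}=\aleph_{\alpha+\kappa}$ if $\chi=\aleph_\alpha$. **Corollary.** Let $\chi>\kappa$ be a cardinal with $\overline{\mathrm{cof}}(NS_{\kappa,\chi})\le\chi^{+\kappa}$. Then there is $A\in NS_{\kappa,\chi^{+\kappa}}^*$ such that $$NS^\chi_{\kappa,\chi^{+\kappa}}|A=NS^\kappa_{\kappa,\chi^{+\kappa}}|A.$$ -/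

import Mathlib

universe u

namespace PkLambda

open Cardinal Ordinal Set

/-- `P_κ(lam)`: the subsets of `lam` of cardinality less than `κ`. The cardinal `lam` is identified
with its initial ordinal, whose elements form the well-ordered type `lam.ord.ToType`. -/
abbrev Pk (κ lam : Cardinal.{u}) : Type u :=
  {a : Set lam.ord.ToType // #a < κ}

/-- `I_{κ,lam}`: the noncofinal subsets of `P_κ(lam)`. -/
def bddIdeal (κ lam : Cardinal.{u}) : Set (Set (Pk κ lam)) :=
  {A | ∃ b : Pk κ lam, ∀ a ∈ A, ¬ b.1 ⊆ a.1}

/-- Ideals on `P_κ(lam)`: proper, `κ`-complete, and containing all noncofinal sets. -/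
structure IsIdeal (κ lam : Cardinal.{u}) (J : Set (Set (Pk κ lam))) : Prop where
  bdd_subset : bddIdeal κ lam ⊆ J
  univ_notMem : Set.univ ∉ J
  mem_of_subset : ∀ A ∈ J, ∀ B, B ⊆ A → B ∈ J
  sUnion_mem : ∀ X ⊆ J, #X < κ → ⋃₀ X ∈ J

/-- The dual filter `J^*`. -/
def dual {κ lam : Cardinal.{u}} (J : Set (Set (Pk κ lam))) : Set (Set (Pk κ lam)) :=
  {A | Aᶜ ∈ J}

/-- The restriction `J | A`. -/
def restrict {κ lam : Cardinal.{u}} (J : Set (Set (Pk κ lam))) (A : Set (Pk κ lam)) :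
    Set (Set (Pk κ lam)) :=
  {B | B ∩ A ∈ J}

/-- `μ`-normal ideals on `P_κ(lam)`: every function `f` on a `J`-positive set `A` with
`f a ∈ a ∩ μ` for all `a ∈ A` is constant on a `J`-positive subset of `A`. (Values of `f` outside
`A` are irrelevant.) -/
structure IsNormalIdeal (κ lam μ : Cardinal.{u}) (J : Set (Set (Pk κ lam))) : Prop
    extends IsIdeal κ lam J where
  normal : ∀ A, A ∉ J → ∀ f : Pk κ lam → lam.ord.ToType,
    (∀ a ∈ A, f a ∈ a.1 ∧ ((f a).toOrd : Ordinal.{u}) < μ.ord) →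
      ∃ B, B ⊆ A ∧ B ∉ J ∧ ∃ c, ∀ b ∈ B, f b = c

/-- `NS^μ_{κ,lam}`: the smallest `μ`-normal ideal on `P_κ(lam)`, as the intersection of all of them;
see `isLeast_NSmu`. -/
def NSmu (κ lam μ : Cardinal.{u}) : Set (Set (Pk κ lam)) :=
  {A | ∀ J, IsNormalIdeal κ lam μ J → A ∈ J}

/-- If there is a `μ`-normal ideal at all, then `NSmu κ lam μ` is the smallest one. -/
theorem isLeast_NSmu {κ lam μ : Cardinal.{u}} (h : ∃ J, IsNormalIdeal κ lam μ J) :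
    IsLeast {J | IsNormalIdeal κ lam μ J} (NSmu κ lam μ) := by
  obtain ⟨J₀, h₀⟩ := h
  refine ⟨⟨⟨fun A hA J hJ => hJ.bdd_subset hA, fun hu => h₀.univ_notMem (hu J₀ h₀),
    fun A hA B hB J hJ => hJ.mem_of_subset A (hA J hJ) B hB,
    fun X hX hc J hJ => hJ.sUnion_mem X (fun A hA => hX hA J hJ) hc⟩, ?_⟩,
    fun J hJ A hA => hA J hJ⟩
  intro A hA f hf
  simp only [NSmu, Set.mem_ofPred_eq, not_forall] at hA
  obtain ⟨J, hJ, hAJ⟩ := hA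
  obtain ⟨B, hBA, hB, hc⟩ := hJ.normal A hAJ f hf
  exact ⟨B, hBA, fun hB' => hB (hB' J hJ), hc⟩

/-- Closed unbounded subsets of `P_κ(lam)`: cofinal, and closed under unions of nonempty
`⊆`-chains of fewer than `κ` members. -/
structure IsClosedUnbounded {κ lam : Cardinal.{u}} (C : Set (Pk κ lam)) : Prop where
  unbounded : ∀ b : Pk κ lam, ∃ a ∈ C, b.1 ⊆ a.1
  closed : ∀ D ⊆ C, D.Nonempty → IsChain (fun a b : Pk κ lam => a.1 ⊆ b.1) D → #D < κ →
    ∀ d : Pk κ lam, d.1 = ⋃ a ∈ D, a.1 → d ∈ C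

/-- `NS_{κ,lam}`: the nonstationary subsets of `P_κ(lam)`. -/
def NS (κ lam : Cardinal.{u}) : Set (Set (Pk κ lam)) :=
  {A | ∃ C : Set (Pk κ lam), IsClosedUnbounded C ∧ Disjoint A C}

/-- The reduced cofinality of `J`: the least size of a `Y ⊆ J` such that every member of `J` is
covered by the union of fewer than `κ` members of `Y`. -/
noncomputable def cofBar {κ lam : Cardinal.{u}} (J : Set (Set (Pk κ lam))) : Cardinal.{u} :=
  sInf {c | ∃ Y ⊆ J, (∀ A ∈ J, ∃ y ⊆ Y, #y < κ ∧ A ⊆ ⋃₀ y) ∧ #Y = c}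

/-- `χ^{+o}`: the `o`-th cardinal after `χ`. Here `preAleph` is the increasing enumeration of all
cardinals, finite ones included. -/
noncomputable def succIter (χ : Cardinal.{u}) (o : Ordinal.{u}) : Cardinal.{u} :=
  preAleph (preAleph.symm χ + o)

end PkLambda

/-! Write `lam` for `χ^{+κ}`. Since `nonclosedIdeal κ lam χ` is `χ`-normal, a set `B` in the least
such ideal comes with an `f : χ^{<ω} → P_κ(lam)` under which no `a ∈ B` is closed. The reduced
cofinality bound yields clubs `C x` of `P_κ(χ)`, indexed by `x < lam`, fewer than `κ` of which
suffice to refine any club. Let `A` be the club of those `a` that contain `0`, have `a ∩ χ ∈ C x`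
for all `x ∈ a`, and are closed under enumerations `j x` of the ordinals `x` by their cardinalities.

If the values of `f` are bounded in `lam`, some `z ∈ P_κ(lam)` forces every `a ∈ A` containing `z`
to be closed under `f` (`captured_of_bounded`). In general, as `lam` has cofinality `κ`, `f` splits
into `κ` bounded pieces. An `a ∈ B ∩ A` must miss part of the set attached to some `i ∈ a ∩ κ`;
choosing `i` is a regressive function into `κ`, so `κ`-normality puts `B ∩ A` in the smaller ideal
(`mem_NSmu_of_captured`). -/

namespace PkLambda

open Cardinal Ordinal Set

/-! ### Closing small sets under functions on finite sequences. -/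

section Closure

variable {κ : Cardinal.{u}} {L : Type u}

/-- The finite sequences with entries in `s`. -/
def lists (s : Set L) : Set (List L) := {l | ∀ x ∈ l, x ∈ s}

theorem lists_mono {s t : Set L} (h : s ⊆ t) : lists s ⊆ lists t :=
  fun _ hl x hx => h (hl x hx)

theorem mk_lists_le (s : Set L) : #(lists s) ≤ max ℵ₀ #s := by
  have : lists s = range (List.map ((↑) : s → L)) := by
    rw [Set.range_list_map_coe]; rfl
  rw [this]
  exact mk_range_le.trans (mk_list_le_max s)

theorem exists_mem_lists_of_directed {ι : Type*} {s : ι → Set L} [Nonempty ι]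
    (hs : Directed (· ⊆ ·) s) {l : List L} (hl : l ∈ lists (⋃ i, s i)) : ∃ i, l ∈ lists (s i) := by
  induction l with
  | nil => exact ⟨Classical.arbitrary ι, by simp [lists]⟩
  | cons x l ih =>
    obtain ⟨i, hi⟩ := ih fun y hy => hl y (List.mem_cons_of_mem _ hy)
    obtain ⟨j, hj⟩ := mem_iUnion.1 (hl x List.mem_cons_self)
    obtain ⟨k, hik, hjk⟩ := hs i j
    refine ⟨k, fun y hy => ?_⟩
    rcases List.mem_cons.1 hy with rfl | hy
    exacts [hjk hj, hik (hi y hy)]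

theorem mk_biUnion_lt (hκ : κ.IsRegular) {α β : Type u} {s : Set α} (hs : #s < κ)
    {t : α → Set β} (ht : ∀ a ∈ s, #(t a) < κ) : #(⋃ a ∈ s, t a : Set β) < κ :=
  (card_biUnion_lt_iff_forall_of_isRegular hκ hs).2 ht

theorem mk_iUnion_nat_lt (hκ : κ.IsRegular) (hω : ℵ₀ < κ) {s : ℕ → Set L}
    (hs : ∀ n, #(s n) < κ) : #(⋃ n, s n : Set L) < κ := by
  have : (⋃ n, s n) = ⋃ n : ULift.{u} ℕ, s n.down := by
    ext x; simp
  rw [this]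
  exact (card_iUnion_lt_iff_forall_of_isRegular hκ (by simpa using hω)).2 fun n => hs n.down

theorem mk_iterate_lt {S : Set L → Set L} (hS : ∀ b : Set L, #b < κ → #(S b) < κ) {b : Set L}
    (hb : #b < κ) (n : ℕ) : #(S^[n] b) < κ := by
  induction n with
  | zero => exact hb
  | succ n ih => rw [Function.iterate_succ_apply']; exact hS _ ih

theorem monotone_iterate {S : Set L → Set L} (hS : ∀ b, b ⊆ S b) (b : Set L) :
    Monotone fun n => S^[n] b :=
  monotone_nat_of_le_succ fun n => by rw [Function.iterate_succ_apply']; exact hS _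

theorem mk_union_lt (hκ : κ.IsRegular) {s t : Set L} (hs : #s < κ) (ht : #t < κ) :
    #(s ∪ t : Set L) < κ :=
  (mk_union_le s t).trans_lt (add_lt_of_lt hκ.1 hs ht)

theorem exists_lists_closed (hκ : κ.IsRegular) (hω : ℵ₀ < κ) {g : List L → Set L}
    (hg : ∀ l, #(g l) < κ) {b : Set L} (hb : #b < κ) :
    ∃ a, b ⊆ a ∧ #a < κ ∧ ∀ l ∈ lists a, g l ⊆ a := by
  let S : Set L → Set L := fun s => s ∪ ⋃ l ∈ lists s, g l
  have hS : ∀ s : Set L, #s < κ → #(S s) < κ := fun s hs =>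
    mk_union_lt hκ hs (mk_biUnion_lt hκ ((mk_lists_le s).trans_lt (max_lt hω hs)) fun l _ => hg l)
  have hmono := monotone_iterate (S := S) (fun s => subset_union_left) b
  refine ⟨⋃ n, S^[n] b, subset_iUnion (fun n => S^[n] b) 0,
    mk_iUnion_nat_lt hκ hω (mk_iterate_lt hS hb), fun l hl => ?_⟩
  obtain ⟨n, hn⟩ := exists_mem_lists_of_directed hmono.directed_le hl
  refine Subset.trans ?_ (subset_iUnion (fun n => S^[n] b) (n + 1))
  simp only [Function.iterate_succ_apply']
  exact (subset_biUnion_of_mem (u := g) hn).trans subset_union_right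

end Closure

/-! ### Elements of a cardinal as ordinals. -/

section Rank

variable {lam : Cardinal.{u}}

/-- The ordinal corresponding to an element of `lam`. -/
noncomputable def rk (x : lam.ord.ToType) : Ordinal.{u} := x.toOrd

theorem rk_lt (x : lam.ord.ToType) : rk x < lam.ord := x.toOrd.2

theorem rk_injective : Function.Injective (rk (lam := lam)) := fun _ _ h =>
  (ToType.mk (o := lam.ord)).symm.injective (Subtype.ext h)

theorem exists_rk_eq {o : Ordinal.{u}} (h : o < lam.ord) : ∃ x : lam.ord.ToType, rk x = o :=
  ⟨ToType.mk ⟨o, h⟩, by simp [rk]⟩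

/-- The inclusion of the cardinal `χ` in `lam` as an initial segment. -/
noncomputable def incl {χ : Cardinal.{u}} (h : χ ≤ lam) (x : χ.ord.ToType) : lam.ord.ToType :=
  ToType.mk ⟨rk x, (rk_lt x).trans_le (ord_le_ord.2 h)⟩

theorem rk_incl {χ : Cardinal.{u}} (h : χ ≤ lam) (x : χ.ord.ToType) : rk (incl h x) = rk x := by
  simp [rk, incl]

theorem incl_injective {χ : Cardinal.{u}} (h : χ ≤ lam) : Function.Injective (incl h) :=
  fun x y hxy => rk_injective <| by rw [← rk_incl h x, ← rk_incl h y, hxy]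

theorem mem_range_incl {χ : Cardinal.{u}} (h : χ ≤ lam) {x : lam.ord.ToType}
    (hx : rk x < χ.ord) : x ∈ range (incl h) := by
  obtain ⟨y, hy⟩ := exists_rk_eq hx
  exact ⟨y, rk_injective (by rw [rk_incl, hy])⟩

/-- The elements of `lam` below the ordinal `o`. -/
def below (o : Ordinal.{u}) : Set lam.ord.ToType := {x | rk x < o}

theorem mk_below_le (o : Ordinal.{u}) : #(below o : Set lam.ord.ToType) ≤ o.card := by
  rw [← mk_toType o]
  refine mk_le_of_injective (f := fun x => ToType.mk ⟨rk x.1, x.2⟩) fun x y h => ?_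
  have := (ToType.mk (o := o)).injective h
  exact Subtype.ext (rk_injective (Subtype.mk.inj this))

/-- An initial segment of `lam` is the image of the initial segment given by its cardinality. -/
theorem exists_enum (x : lam.ord.ToType) : ∃ j : lam.ord.ToType → lam.ord.ToType,
    ∀ y, rk y < rk x → ∃ w, rk w < (rk x).card.ord ∧ j w = y := by
  have h : #(below (rk x) : Set lam.ord.ToType) ≤ #((rk x).card.ord.ToType) := by
    simpa using mk_below_le (rk x)
  obtain ⟨e⟩ := h
  let emb := incl (lt_ord.1 (rk_lt x)).le
  have hinj : Function.Injective emb := incl_injective _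
  have : Function.Injective fun y : below (rk x) => emb (e y) := hinj.comp e.injective
  refine ⟨Function.extend (fun y : below (rk x) => emb (e y)) Subtype.val fun _ => x,
    fun y hy => ⟨emb (e ⟨y, hy⟩), ?_, this.extend_apply _ _ ⟨y, hy⟩⟩⟩
  rw [rk_incl]
  exact rk_lt _

end Rank

/-! ### The normal ideal given by functions on finite sequences. -/

section Functions

variable {κ lam μ : Cardinal.{u}}

/-- The sets all of whose members `a` fail to be closed under some fixed function from finite
sequences to `P_κ(lam)`, tested on sequences in `a ∩ μ`. -/
def nonclosedIdeal (κ lam μ : Cardinal.{u}) : Set (Set (Pk κ lam)) :=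
  {B | ∃ f : List lam.ord.ToType → Set lam.ord.ToType, (∀ l, #(f l) < κ) ∧
    ∀ a ∈ B, ∃ l ∈ lists (a.1 ∩ below μ.ord), ¬ f l ⊆ a.1}

/-- Only this upper bound on `NSmu` is needed: it turns membership into a concrete function. -/
theorem isNormalIdeal_nonclosedIdeal (hκ : κ.IsRegular) (hω : ℵ₀ < κ) :
    IsNormalIdeal κ lam μ (nonclosedIdeal κ lam μ) where
  bdd_subset := by
    rintro A ⟨b, hb⟩
    exact ⟨fun _ => b.1, fun _ => b.2, fun a ha => ⟨[], by simp [lists], hb a ha⟩⟩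
  univ_notMem := by
    rintro ⟨f, hf, h⟩
    obtain ⟨a, -, ha, hfa⟩ := exists_lists_closed hκ hω hf (b := ∅) (by simpa using hκ.pos)
    obtain ⟨l, hl, hl'⟩ := h ⟨a, ha⟩ (mem_univ _)
    exact hl' (hfa l (lists_mono inter_subset_left hl))
  mem_of_subset := by
    rintro A ⟨f, hf, h⟩ B hB
    exact ⟨f, hf, fun a ha => h a (hB ha)⟩
  sUnion_mem := by
    intro X hX hXc
    have : ∀ B, ∃ f : List lam.ord.ToType → Set lam.ord.ToType, B ∈ X → (∀ l, #(f l) < κ) ∧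
        ∀ a ∈ B, ∃ l ∈ lists (a.1 ∩ below μ.ord), ¬ f l ⊆ a.1 := fun B => by
      by_cases h : B ∈ X
      · obtain ⟨f, hf⟩ := hX h
        exact ⟨f, fun _ => hf⟩
      · exact ⟨fun _ => ∅, fun h' => (h h').elim⟩
    choose F hF using this
    refine ⟨fun l => ⋃ B ∈ X, F B l, fun l => mk_biUnion_lt hκ hXc fun B hB => (hF B hB).1 l, ?_⟩
    rintro a ⟨B, hB, ha⟩
    obtain ⟨l, hl, hl'⟩ := (hF B hB).2 a ha
    exact ⟨l, hl, fun h => hl' ((subset_biUnion_of_mem (u := fun B => F B l) hB).trans h)⟩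
  normal := by
    intro A hA f hf
    by_contra! hcon
    have : ∀ c, ∃ F : List lam.ord.ToType → Set lam.ord.ToType, (∀ l, #(F l) < κ) ∧
        ∀ a ∈ A, f a = c → ∃ l ∈ lists (a.1 ∩ below μ.ord), ¬ F l ⊆ a.1 := fun c => by
      by_cases h : {a ∈ A | f a = c} ∈ nonclosedIdeal κ lam μ
      · obtain ⟨F, hF, h⟩ := h
        exact ⟨F, hF, fun a ha hac => h a ⟨ha, hac⟩⟩
      · obtain ⟨b, hb, hb'⟩ := hcon _ (fun a ha => ha.1) h c
        exact (hb' hb.2).elim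
    choose F hF hFA using this
    -- Diagonal union: the head of the sequence names the value `c` of the regressive function, the
    -- tail is fed to `F c`.
    refine hA ⟨fun | [] => ∅ | c :: l => F c l, ?_, fun a ha => ?_⟩
    · rintro (_ | ⟨c, l⟩)
      · simpa using hκ.pos
      · exact hF c l
    · obtain ⟨l, hl, hl'⟩ := hFA (f a) a ha rfl
      refine ⟨f a :: l, fun x hx => ?_, hl'⟩
      rcases List.mem_cons.1 hx with rfl | hx
      exacts [⟨(hf a ha).1, (hf a ha).2⟩, hl x hx]

theorem NSmu_subset_nonclosedIdeal (hκ : κ.IsRegular) (hω : ℵ₀ < κ) :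
    NSmu κ lam μ ⊆ nonclosedIdeal κ lam μ :=
  fun _ hA => hA _ (isNormalIdeal_nonclosedIdeal hκ hω)

theorem NSmu_mono {ν : Cardinal.{u}} (h : ν ≤ μ) : NSmu κ lam ν ⊆ NSmu κ lam μ :=
  fun _ hA J hJ => hA J ⟨hJ.toIsIdeal, fun B hB f hf => hJ.normal B hB f fun a ha =>
    ⟨(hf a ha).1, (hf a ha).2.trans_le (ord_le_ord.2 h)⟩⟩

end Functions

/-! ### The club of closure points. -/

section Club

variable {κ χ lam : Cardinal.{u}}

/-- The intersection of a member of `P_κ(lam)` with `χ`, as a member of `P_κ(χ)`. -/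
noncomputable def trace (h : χ ≤ lam) (a : Pk κ lam) : Pk κ χ :=
  ⟨incl h ⁻¹' a.1, (mk_preimage_of_injective _ _ (incl_injective h)).trans_lt a.2⟩

theorem trace_mono (h : χ ≤ lam) {a b : Pk κ lam} (hab : a.1 ⊆ b.1) :
    (trace h a).1 ⊆ (trace h b).1 :=
  preimage_mono hab

/-- The sets `a` in `P_κ(lam)` that contain `o`, are closed under `j`, and whose intersection
with `χ` belongs to every `C x` with `x ∈ a`. -/
def closurePoints (h : χ ≤ lam) (C : lam.ord.ToType → Set (Pk κ χ))
    (j : lam.ord.ToType → lam.ord.ToType → lam.ord.ToType) (o : lam.ord.ToType) :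
    Set (Pk κ lam) :=
  {a | o ∈ a.1 ∧ ∀ x ∈ a.1, trace h a ∈ C x ∧ ∀ y ∈ a.1, j x y ∈ a.1}

/-- Interleaves one member of each `C x` between consecutive traces, so that after `ω` steps the
trace is an increasing union of members of `C x`. -/
theorem exists_step (hκ : κ.IsRegular) (hω : ℵ₀ < κ) (h : χ ≤ lam)
    {C : lam.ord.ToType → Set (Pk κ χ)} (hC : ∀ x, IsClosedUnbounded (C x))
    (j : lam.ord.ToType → lam.ord.ToType → lam.ord.ToType) (o : lam.ord.ToType) (a : Pk κ lam) :
    ∃ b : Pk κ lam, a.1 ⊆ b.1 ∧ o ∈ b.1 ∧ ∀ x ∈ a.1,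
      (∃ c ∈ C x, (trace h a).1 ⊆ c.1 ∧ c.1 ⊆ (trace h b).1) ∧ ∀ y ∈ a.1, j x y ∈ b.1 := by
  choose c hc hac using fun x => (hC x).unbounded (trace h a)
  have hsub : a.1 ⊆ a.1 ∪ ({o} ∪ ⋃ x ∈ a.1, (incl h '' (c x).1 ∪ j x '' a.1)) :=
    subset_union_left
  have hx : ∀ x ∈ a.1, incl h '' (c x).1 ∪ j x '' a.1 ⊆
      a.1 ∪ ({o} ∪ ⋃ x ∈ a.1, (incl h '' (c x).1 ∪ j x '' a.1)) := fun x hx =>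
    (subset_biUnion_of_mem (u := fun x => incl h '' (c x).1 ∪ j x '' a.1) hx).trans
      (subset_union_right.trans subset_union_right)
  refine ⟨⟨a.1 ∪ ({o} ∪ ⋃ x ∈ a.1, (incl h '' (c x).1 ∪ j x '' a.1)), ?_⟩, hsub, by simp,
    fun x hxa => ⟨⟨c x, hc x, hac x, fun y hy => ?_⟩, fun y hy => ?_⟩⟩
  · refine mk_union_lt hκ a.2 (mk_union_lt hκ ?_ (mk_biUnion_lt hκ a.2 fun x _ =>
      mk_union_lt hκ (mk_image_le.trans_lt (c x).2) (mk_image_le.trans_lt a.2)))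
    simpa using one_lt_aleph0.trans hω
  · exact hx x hxa (Or.inl ⟨y, hy, rfl⟩)
  · exact hx x hxa (Or.inr ⟨y, hy, rfl⟩)

theorem isClosedUnbounded_closurePoints (hκ : κ.IsRegular) (hω : ℵ₀ < κ) (h : χ ≤ lam)
    {C : lam.ord.ToType → Set (Pk κ χ)} (hC : ∀ x, IsClosedUnbounded (C x))
    (j : lam.ord.ToType → lam.ord.ToType → lam.ord.ToType) (o : lam.ord.ToType) :
    IsClosedUnbounded (closurePoints h C j o) where
  unbounded b := by
    choose S hS ho hSC using exists_step hκ hω h hC j o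
    let s : ℕ → Pk κ lam := fun n => S^[n] b
    have hs : ∀ n, s (n + 1) = S (s n) := fun n => Function.iterate_succ_apply' S n b
    have hmono : Monotone fun n => (s n).1 :=
      monotone_nat_of_le_succ fun n => by rw [hs]; exact hS _
    have hsub : ∀ n, (s n).1 ⊆ ⋃ n, (s n).1 := subset_iUnion fun n => (s n).1
    refine ⟨⟨⋃ n, (s n).1, mk_iUnion_nat_lt hκ hω fun n => (s n).2⟩, ⟨?_, fun x hx => ⟨?_, ?_⟩⟩,
      hsub 0⟩
    · exact hsub 1 (by rw [hs]; exact ho _)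
    · obtain ⟨m, hm⟩ := mem_iUnion.1 hx
      have : ∀ k, ∃ c ∈ C x, (trace h (s (m + k))).1 ⊆ c.1 ∧ c.1 ⊆ (trace h (s (m + k + 1))).1 :=
        fun k => by
          obtain ⟨c, hc⟩ := (hSC (s (m + k)) x (hmono (Nat.le_add_right m k) hm)).1
          exact ⟨c, by rwa [hs]⟩
      choose c hcC hc hc' using this
      have hcm : Monotone fun k => (c k).1 :=
        monotone_nat_of_le_succ fun k => (hc' k).trans (hc (k + 1))
      refine (hC x).closed (range c) (range_subset_iff.2 hcC) (range_nonempty c) ?_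
        ((countable_range c).le_aleph0.trans_lt hω) _ ?_
      · rintro _ ⟨k, rfl⟩ _ ⟨l, rfl⟩ -
        exact (le_total k l).imp (fun h => hcm h) (fun h => hcm h)
      · ext y
        simp only [trace, mem_preimage, mem_iUnion, mem_range,
          iUnion_exists, iUnion_iUnion_eq']
        constructor
        · rintro ⟨n, hn⟩
          exact ⟨n, hc n (hmono (Nat.le_add_left n m) hn)⟩
        · rintro ⟨n, hn⟩
          exact ⟨_, hc' n hn⟩
    · intro y hy
      obtain ⟨m, hm⟩ := mem_iUnion.1 hx
      obtain ⟨n, hn⟩ := mem_iUnion.1 hy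
      refine hsub (max m n + 1) ?_
      rw [hs]
      exact (hSC _ x (hmono (le_max_left m n) hm)).2 y (hmono (le_max_right m n) hn)
  closed D hD hne hchain hcard d hd := by
    have hmem : ∀ {x}, x ∈ d.1 → ∃ a ∈ D, x ∈ a.1 := fun {x} hx => by
      rw [hd] at hx
      simpa using hx
    have hsub : ∀ a ∈ D, a.1 ⊆ d.1 := fun a ha => by
      rw [hd]
      exact subset_biUnion_of_mem (u := fun a : Pk κ lam => a.1) ha
    have hdir : ∀ {x y}, x ∈ d.1 → y ∈ d.1 → ∃ a ∈ D, x ∈ a.1 ∧ y ∈ a.1 := fun hx hy => by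
      obtain ⟨a, ha, hxa⟩ := hmem hx
      obtain ⟨b, hb, hyb⟩ := hmem hy
      have : Std.Refl (fun a b : Pk κ lam => a.1 ⊆ b.1) := ⟨fun a => Subset.rfl⟩
      rcases hchain.total ha hb with hab | hab
      exacts [⟨b, hb, hab hxa, hyb⟩, ⟨a, ha, hxa, hab hyb⟩]
    refine ⟨?_, fun x hx => ⟨?_, fun y hy => ?_⟩⟩
    · obtain ⟨a, ha⟩ := hne
      exact hsub a ha (hD ha).1
    -- Only the members of the chain containing `x` have their trace in `C x`; they are cofinal in
    -- the chain, so the union is unchanged.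
    · refine (hC x).closed (trace h '' {a ∈ D | x ∈ a.1}) ?_ ?_ ?_ ?_ _ ?_
      · rintro _ ⟨a, ha, rfl⟩
        exact ((hD ha.1).2 x ha.2).1
      · obtain ⟨a, ha⟩ := hmem hx
        exact ⟨_, a, ha, rfl⟩
      · rintro _ ⟨a, ha, rfl⟩ _ ⟨b, hb, rfl⟩ hab
        exact (hchain ha.1 hb.1 fun h' => hab (by rw [h'])).imp (trace_mono h) (trace_mono h)
      · exact mk_image_le.trans_lt ((mk_le_mk_of_subset fun a ha => ha.1).trans_lt hcard)
      · ext y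
        simp only [mem_iUnion, exists_prop]
        constructor
        · intro hy
          obtain ⟨a, ha, hxa, hya⟩ := hdir hx hy
          exact ⟨_, ⟨a, ⟨ha, hxa⟩, rfl⟩, hya⟩
        · rintro ⟨_, ⟨a, ha, rfl⟩, hy⟩
          exact hsub a ha.1 hy
    · obtain ⟨a, ha, hxa, hya⟩ := hdir hx hy
      exact hsub a ha (((hD ha).2 x hxa).2 y hya)

/-- The members of `P_κ(χ)` closed under a function with small values form a closed unbounded
set. -/
theorem isClosedUnbounded_lists (hκ : κ.IsRegular) (hω : ℵ₀ < κ)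
    {g : List χ.ord.ToType → Set χ.ord.ToType} (hg : ∀ l, #(g l) < κ) :
    IsClosedUnbounded {c : Pk κ χ | ∀ l ∈ lists c.1, g l ⊆ c.1} where
  unbounded b := by
    obtain ⟨a, hba, ha, hga⟩ := exists_lists_closed hκ hω hg b.2
    exact ⟨⟨a, ha⟩, hga, hba⟩
  closed D hD hne hchain _ d hd l hl := by
    have : Nonempty D := hne.to_subtype
    have hdir : Directed (· ⊆ ·) fun a : D => a.1.1 := by
      have : Std.Refl (fun a b : Pk κ χ => a.1 ⊆ b.1) := ⟨fun a => Subset.rfl⟩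
      rintro ⟨a, ha⟩ ⟨b, hb⟩
      rcases hchain.total ha hb with hab | hab
      exacts [⟨⟨b, hb⟩, hab, Subset.rfl⟩, ⟨⟨a, ha⟩, Subset.rfl, hab⟩]
    rw [hd, biUnion_eq_iUnion] at hl ⊢
    obtain ⟨a, ha⟩ := exists_mem_lists_of_directed hdir hl
    exact (hD a.2 l ha).trans (subset_iUnion (fun a : D => a.1.1) a)

/-- The witnesses to `cofBar (NS κ χ) ≤ lam` as a family of closed unbounded sets. -/
theorem exists_club_family (hκ : κ.IsRegular) (hcof : cofBar (NS κ χ) ≤ lam) :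
    ∃ C : lam.ord.ToType → Set (Pk κ χ), (∀ x, IsClosedUnbounded (C x)) ∧
      ∀ N ∈ NS κ χ, ∃ z : Set lam.ord.ToType, #z < κ ∧ ∀ c, (∀ x ∈ z, c ∈ C x) → c ∉ N := by
  obtain ⟨Y, hY, hcov, hYc⟩ : cofBar (NS κ χ) ∈
      {c | ∃ Y ⊆ NS κ χ, (∀ A ∈ NS κ χ, ∃ y ⊆ Y, #y < κ ∧ A ⊆ ⋃₀ y) ∧ #Y = c} := by
    refine csInf_mem ⟨_, NS κ χ, Subset.rfl, fun A hA => ⟨{A}, by simpa using hA, ?_, by simp⟩, rfl⟩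
    simpa using one_lt_aleph0.trans_le hκ.1
  rw [← hYc, ← card_ord lam, ← mk_toType] at hcof
  obtain ⟨e⟩ := hcof
  have : ∀ x, ∃ C : Set (Pk κ χ), IsClosedUnbounded C ∧
      ∀ y : Y, e y = x → Disjoint y.1 C := fun x => by
    by_cases hx : ∃ y, e y = x
    · obtain ⟨y, rfl⟩ := hx
      obtain ⟨C, hC, hyC⟩ := hY y.2
      exact ⟨C, hC, fun y' hy' => by rwa [e.injective hy']⟩
    · exact ⟨univ, ⟨fun b => ⟨b, mem_univ b, Subset.rfl⟩, fun _ _ _ _ _ _ _ => mem_univ _⟩,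
        fun y hy => (hx ⟨y, hy⟩).elim⟩
  choose C hC hCY using this
  refine ⟨C, hC, fun N hN => ?_⟩
  obtain ⟨y, hyY, hy, hNy⟩ := hcov N hN
  refine ⟨range fun t : y => e ⟨t.1, hyY t.2⟩, mk_range_le.trans_lt hy, fun c hc hcN => ?_⟩
  obtain ⟨t, ht, hct⟩ := hNy hcN
  exact (hCY _ ⟨t, hyY ht⟩ rfl).le_bot ⟨hct, hc _ ⟨⟨t, ht⟩, rfl⟩⟩

end Club

/-! ### Capturing functions by small sets. -/

section Captured

variable {κ χ lam : Cardinal.{u}}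

/-- Some fixed member `z` of `P_κ(lam)` is such that every `a ∈ A` containing `z` is closed under
`f` on sequences in `a ∩ χ`. -/
def Captured (χ : Cardinal.{u}) (A : Set (Pk κ lam))
    (f : List lam.ord.ToType → Set lam.ord.ToType) : Prop :=
  ∃ z : Set lam.ord.ToType, #z < κ ∧
    ∀ a ∈ A, z ⊆ a.1 → ∀ l ∈ lists (a.1 ∩ below χ.ord), f l ⊆ a.1

theorem Captured.of_subset {A : Set (Pk κ lam)} {f g : List lam.ord.ToType → Set lam.ord.ToType}
    (hg : Captured χ A g) (h : ∀ l ∈ lists (below χ.ord), f l ⊆ g l) : Captured χ A f := by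
  obtain ⟨z, hz, hzA⟩ := hg
  exact ⟨z, hz, fun a ha hza l hl =>
    (h l (lists_mono inter_subset_right hl)).trans (hzA a ha hza l hl)⟩

theorem Captured.iUnion (hκ : κ.IsRegular) {A : Set (Pk κ lam)} {ι : Type u} (hι : #ι < κ)
    {F : ι → List lam.ord.ToType → Set lam.ord.ToType} (hF : ∀ i, Captured χ A (F i)) :
    Captured χ A fun l => ⋃ i, F i l := by
  choose z hz hzA using hF
  refine ⟨⋃ i, z i, (card_iUnion_lt_iff_forall_of_isRegular hκ hι).2 hz,
    fun a ha hza l hl => iUnion_subset fun i => hzA i a ha ((subset_iUnion z i).trans hza) l hl⟩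

variable {h : χ ≤ lam} {C : lam.ord.ToType → Set (Pk κ χ)}
  {j : lam.ord.ToType → lam.ord.ToType → lam.ord.ToType} {o : lam.ord.ToType}

/-- Here `f` acts on `χ` alone, so its closed sets form a club of `P_κ(χ)`; `z` indexes the fewer
than `κ` clubs `C x` refining it. -/
theorem captured_of_subset_below (hκ : κ.IsRegular) (hω : ℵ₀ < κ)
    (hcov : ∀ N ∈ NS κ χ, ∃ z : Set lam.ord.ToType, #z < κ ∧ ∀ c, (∀ x ∈ z, c ∈ C x) → c ∉ N)
    {f : List lam.ord.ToType → Set lam.ord.ToType} (hf : ∀ l, #(f l) < κ)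
    (hfχ : ∀ l, f l ⊆ below χ.ord) : Captured χ (closurePoints h C j o) f := by
  let g : List χ.ord.ToType → Set χ.ord.ToType := fun l => incl h ⁻¹' f (l.map (incl h))
  have hg : ∀ l, #(g l) < κ := fun l =>
    (mk_preimage_of_injective _ _ (incl_injective h)).trans_lt (hf _)
  obtain ⟨z, hz, hzN⟩ := hcov {c | ∀ l ∈ lists c.1, g l ⊆ c.1}ᶜ
    ⟨_, isClosedUnbounded_lists hκ hω hg, disjoint_compl_left⟩
  refine ⟨z, hz, fun a ha hza l hl y hy => ?_⟩
  have hta := not_not.1 (hzN (trace h a) fun x hx => (ha.2 x (hza hx)).1)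
  have : l ∈ range (List.map (incl h)) := by
    rw [Set.range_list_map]
    exact fun x hx => mem_range_incl h (hl x hx).2
  obtain ⟨l, rfl⟩ := this
  obtain ⟨y, rfl⟩ := mem_range_incl h (hfχ _ hy)
  exact hta l (fun x hx => (hl _ (List.mem_map_of_mem hx)).1) hy

/-- Reduction from values below an ordinal to values below its cardinality. -/
theorem captured_of_card (hκ : κ.IsRegular) {x : lam.ord.ToType}
    (hj : ∀ y, rk y < rk x → ∃ w, rk w < (rk x).card.ord ∧ j x w = y)
    {f : List lam.ord.ToType → Set lam.ord.ToType} (hf : ∀ l, #(f l) < κ)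
    (hfx : ∀ l, f l ⊆ below (rk x))
    (hcard : ∀ g : List lam.ord.ToType → Set lam.ord.ToType, (∀ l, #(g l) < κ) →
      (∀ l, g l ⊆ below (rk x).card.ord) → Captured χ (closurePoints h C j o) g) :
    Captured χ (closurePoints h C j o) f := by
  have : Nonempty lam.ord.ToType := ⟨x⟩
  choose! w hw hjw using hj
  obtain ⟨z, hz, hzA⟩ := hcard (fun l => w '' f l) (fun l => mk_image_le.trans_lt (hf l)) (by
    rintro l _ ⟨y, hy, rfl⟩
    exact hw y (hfx l hy))
  refine ⟨z ∪ {x}, mk_union_lt hκ hz (by simpa using one_lt_aleph0.trans_le hκ.1),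
    fun a ha hza l hl y hy => ?_⟩
  have hx : x ∈ a.1 := hza (Or.inr rfl)
  have := (ha.2 x hx).2 _ (hzA a ha (subset_union_left.trans hza) l hl ⟨y, hy, rfl⟩)
  rwa [hjw y (hfx l hy)] at this

/-- Induction on the bound `δ`, with base `δ ≤ χ`. A non-cardinal `δ` is replaced by its cardinality
through `j`. -/
theorem captured_of_bounded (hκ : κ.IsRegular) (hω : ℵ₀ < κ) (hκχ : κ ≤ χ)
    (hcov : ∀ N ∈ NS κ χ, ∃ z : Set lam.ord.ToType, #z < κ ∧ ∀ c, (∀ x ∈ z, c ∈ C x) → c ∉ N)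
    (hj : ∀ x y, rk y < rk x → ∃ w, rk w < (rk x).card.ord ∧ j x w = y)
    (hlam : ∀ μ : Cardinal.{u}, χ < μ → μ < lam → μ.IsRegular ∨ μ.ord.cof < κ)
    {δ : Ordinal.{u}} (hδ : δ < lam.ord)
    {f : List lam.ord.ToType → Set lam.ord.ToType} (hf : ∀ l, #(f l) < κ)
    (hfδ : ∀ l, f l ⊆ below δ) : Captured χ (closurePoints h C j o) f := by
  induction δ using WellFoundedLT.induction generalizing f with
  | ind δ ih =>
  rcases le_or_gt δ χ.ord with hδχ | hδχ
  · exact captured_of_subset_below hκ hω hcov hf fun l x hx =>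
      lt_of_lt_of_le (show rk x < δ from hfδ l hx) hδχ
  rcases (ord_card_le δ).lt_or_eq with hcard | hcard
  · obtain ⟨x, rfl⟩ := exists_rk_eq hδ
    exact captured_of_card hκ (hj x) hf hfδ fun g hg hgx => ih _ hcard (hcard.trans hδ) hg hgx
  obtain ⟨μ, rfl⟩ : ∃ μ : Cardinal, δ = μ.ord := ⟨_, hcard.symm⟩
  have hχμ : χ < μ := ord_lt_ord.1 hδχ
  have hωχ : ℵ₀ < χ := hω.trans_le hκχ
  -- Regular `μ`: there are at most `χ < μ` sequences, so the values are bounded below `μ`.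
  rcases hlam μ hχμ (ord_lt_ord.1 hδ) with hμ | hμ
  · let R : Set lam.ord.ToType := ⋃ l ∈ lists (below χ.ord), f l
    have hR : #R < μ.ord.cof := by
      rw [hμ.cof_ord]
      refine mk_biUnion_lt hμ ((mk_lists_le _).trans_lt (max_lt (hωχ.trans hχμ) ?_))
        fun l _ => (hf l).trans_le (hκχ.trans hχμ.le)
      exact (mk_below_le _).trans_lt (by rwa [card_ord])
    have hRμ : ∀ y : R, rk y.1 < μ.ord := fun y => by
      obtain ⟨l, -, hl⟩ := mem_iUnion₂.1 y.2
      exact hfδ l hl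
    have hsup := iSup_add_one_lt_of_lt_cof hR hRμ
    classical
    refine Captured.of_subset (g := fun l => if l ∈ lists (below χ.ord) then f l else ∅)
      (ih _ hsup (hsup.trans hδ) (fun l => ?_) fun l => ?_) fun l hl => by rw [if_pos hl]
    · split_ifs
      exacts [hf l, by simpa using hκ.pos]
    · split_ifs with hl
      · intro y hy
        exact lt_of_lt_of_le (lt_add_one _)
          (Ordinal.le_iSup (fun y : R => rk y.1 + 1) ⟨y, mem_biUnion hl hy⟩)
      · exact empty_subset _
  -- Cofinality below `κ`: cut `f` along a short cofinal set and take the union of the capturing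
  -- sets.
  · rw [← cof_toType] at hμ
    obtain ⟨s, hs, hsμ⟩ := Order.exists_cof_eq μ.ord.ToType
    rw [← hsμ] at hμ
    have hlim : Order.IsSuccLimit μ.ord := isSuccLimit_ord (hωχ.trans hχμ).le
    refine Captured.of_subset (Captured.iUnion hκ hμ
      (F := fun i l => f l ∩ below (Order.succ (rk i.1))) fun i => ?_) fun l _ y hy => ?_
    · have := hlim.succ_lt (rk_lt i.1)
      exact ih _ this (this.trans hδ) (fun l => (mk_le_mk_of_subset inter_subset_left).trans_lt (hf l))
        fun l => inter_subset_right
    · obtain ⟨i, hi, hyi⟩ := hs (ToType.mk ⟨rk y, hfδ l hy⟩)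
      have hle : rk y ≤ rk i := by
        have := (ToType.mk (o := μ.ord)).symm.monotone hyi
        rwa [OrderIso.symm_apply_apply] at this
      exact mem_iUnion.2 ⟨⟨i, hi⟩, hy, Order.lt_succ_iff.2 hle⟩

/-- On a set of closure points with the stated capturing property, regressive functions into `κ`
suffice to show that a member of the `χ`-normal ideal lies in `NSmu κ lam κ`. -/
theorem mem_NSmu_of_captured (hκ : κ.IsRegular) {A : Set (Pk κ lam)} (ho : rk o = 0)
    (hoA : ∀ a ∈ A, o ∈ a.1)
    (lev : Set lam.ord.ToType → lam.ord.ToType) (hlev : ∀ s : Set lam.ord.ToType, #s < κ → rk (lev s) < κ.ord)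
    (hcap : ∀ f : List lam.ord.ToType → Set lam.ord.ToType, (∀ l, #(f l) < κ) →
      ∀ i, rk i < κ.ord → (∀ l, f l ≠ ∅ → lev (f l) = i) → Captured χ A f)
    (hcapκ : ∀ f : List lam.ord.ToType → Set lam.ord.ToType, (∀ l, #(f l) < κ) →
      (∀ l, f l ⊆ below κ.ord) → Captured χ A f)
    {B : Set (Pk κ lam)} (hBA : B ⊆ A) (hB : B ∈ nonclosedIdeal κ lam χ) : B ∈ NSmu κ lam κ := by
  classical
  obtain ⟨f, hf, hfB⟩ := hB
  have hsing : ∀ x : lam.ord.ToType, #({x} : Set lam.ord.ToType) < κ := fun x => by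
    simpa using one_lt_aleph0.trans_le hκ.1
  have hempty : #(∅ : Set lam.ord.ToType) < κ := by simpa using hκ.pos
  -- This `z` ensures that the level of `f l` itself belongs to `a`.
  obtain ⟨z, hz, hzA⟩ := hcapκ (fun l => {lev (f l)}) (fun l => hsing _) fun l =>
    singleton_subset_iff.2 (hlev _ (hf l))
  have : ∀ i, ∃ g : Set lam.ord.ToType, #g < κ ∧ (rk i < κ.ord → ∀ a ∈ A, g ⊆ a.1 →
      ∀ l ∈ lists (a.1 ∩ below χ.ord), lev (f l) = i → f l ⊆ a.1) := fun i => by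
    by_cases hi : rk i < κ.ord
    · obtain ⟨g, hg, hgA⟩ := hcap (fun l => if lev (f l) = i then f l else ∅)
        (fun l => by split_ifs; exacts [hf l, hempty]) i hi
        (fun l => by split_ifs with h <;> simp [h])
      refine ⟨g, hg, fun _ a ha hga l hl hli => ?_⟩
      simpa [hli] using hgA a ha hga l hl
    · exact ⟨∅, hempty, fun hi' => (hi hi').elim⟩
  choose g hg hgA using this
  intro J hJ
  by_contra hBJ
  -- Otherwise `a` would be closed under `f`. Since `0 ∈ a`, the index set `a ∩ κ` is nonempty,
  -- which is what gives `z ⊆ a`.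
  have : ∀ a : Pk κ lam, ∃ i, a ∈ B → i ∈ a.1 ∧ rk i < κ.ord ∧ ¬ g i ∪ z ⊆ a.1 := fun a => by
    by_cases haB : a ∈ B
    · by_contra! hcon
      have key : ∀ i ∈ a.1, rk i < κ.ord → g i ∪ z ⊆ a.1 := fun i hi hiκ => (hcon i).2 hi hiκ
      have hza : z ⊆ a.1 := subset_union_right.trans
        (key o (hoA a (hBA haB)) (by rw [ho]; exact hκ.ord_pos))
      obtain ⟨l, hl, hl'⟩ := hfB a haB
      have hmem : lev (f l) ∈ a.1 := hzA a (hBA haB) hza l hl rfl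
      have hlt := hlev _ (hf l)
      exact hl' (hgA _ hlt a (hBA haB) (subset_union_left.trans (key _ hmem hlt)) l hl rfl)
    · exact ⟨o, fun h' => (haB h').elim⟩
  choose F hF using this
  obtain ⟨E, hEB, hEJ, c, hc⟩ := hJ.normal B hBJ F fun a ha => ⟨(hF a ha).1, (hF a ha).2.1⟩
  -- With a constant index `c`, no member of `E` contains the fixed small set `g c ∪ z`, so `E` is
  -- noncofinal.
  refine hEJ (hJ.bdd_subset ⟨⟨g c ∪ z, mk_union_lt hκ (hg c) hz⟩, fun a ha => ?_⟩)
  have := (hF a (hEB ha)).2.2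
  rwa [hc a ha] at this

end Captured

/-! ### Cardinals between `χ` and `χ^{+κ}`. -/

section SuccIter

variable {κ χ : Cardinal.{u}}

theorem lt_succIter {i : Ordinal.{u}} (hi : 0 < i) : χ < succIter χ i := by
  rw [succIter, ← OrderIso.symm_apply_lt]
  exact (lt_add_iff_pos_right _).2 hi

theorem succIter_lt_succIter {i k : Ordinal.{u}} (h : i < k) : succIter χ i < succIter χ k :=
  preAleph_lt_preAleph.2 (by gcongr)

/-- Such a `μ` is `χ^{+i}` with `0 < i < κ`: a successor cardinal, or a limit whose cofinality is
that of `i`. -/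
theorem isRegular_or_cof_lt (hχ : ℵ₀ ≤ χ) {μ : Cardinal.{u}} (h : χ < μ)
    (hμ : μ < succIter χ κ.ord) : μ.IsRegular ∨ μ.ord.cof < κ := by
  obtain ⟨β, rfl⟩ := preAleph.surjective μ
  obtain ⟨α, rfl⟩ := preAleph.surjective χ
  rw [preAleph_lt_preAleph] at h
  rw [succIter, preAleph_lt_preAleph, OrderIso.symm_apply_apply] at hμ
  by_cases hβ : Order.IsSuccPrelimit β
  · right
    rw [ord_preAleph, cof_preOmega hβ]
    obtain ⟨i, rfl⟩ := exists_add_of_le h.le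
    rw [cof_add _ (by rintro rfl; simp at h)]
    exact (cof_le_card i).trans_lt (lt_ord.1 (by simpa using hμ))
  · left
    obtain ⟨γ, rfl⟩ := Order.not_isSuccPrelimit_iff_mem_range_succ.1 hβ
    rw [Order.succ_eq_add_one] at h ⊢
    exact isRegular_preAleph_add_one ((aleph0_le_preAleph.1 hχ).trans (Order.lt_add_one_iff.1 h))

theorem exists_subset_below_succIter (hκ : κ.IsRegular)
    {s : Set (succIter χ κ.ord).ord.ToType} (hs : #s < κ) :
    ∃ i < κ.ord, s ⊆ below (succIter χ i).ord := by
  have : ∀ x : s, ∃ d < κ.ord, (rk x.1).card ≤ succIter χ d := fun x => by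
    have : (rk x.1).card < preAleph (preAleph.symm χ + κ.ord) := lt_ord.1 (rk_lt x.1)
    rw [← OrderIso.symm_apply_lt, lt_add_iff hκ.ord_pos.ne'] at this
    obtain ⟨d, hd, hxd⟩ := this
    exact ⟨d, hd, (OrderIso.symm_apply_le preAleph).1 hxd⟩
  choose d hd hxd using this
  refine ⟨⨆ x, d x + 1, iSup_add_one_lt_of_lt_cof (by rwa [hκ.cof_ord]) hd, fun x hx => ?_⟩
  refine lt_ord.2 ((hxd ⟨x, hx⟩).trans_lt (succIter_lt_succIter ?_))
  exact lt_of_lt_of_le (lt_add_one _) (Ordinal.le_iSup (fun x => d x + 1) ⟨x, hx⟩)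

end SuccIter

/-- If the reduced cofinality of `NS κ χ` is at most `χ^{+κ}`, then on some closed unbounded set
`χ`-normality reduces to `κ`-normality. -/
theorem exists_restrict_NSmu_eq {κ χ : Cardinal.{u}} (hκ : κ.IsRegular) (hκ_unc : ℵ₀ < κ)
    (hχ : κ < χ) (hcof : cofBar (NS κ χ) ≤ succIter χ κ.ord) :
    ∃ A ∈ dual (NS κ (succIter χ κ.ord)),
      restrict (NSmu κ (succIter χ κ.ord) χ) A = restrict (NSmu κ (succIter χ κ.ord) κ) A := by
  have hχlam : χ < succIter χ κ.ord := lt_succIter hκ.ord_pos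
  set lam := succIter χ κ.ord with hlam
  have hlamκ : κ.ord < lam.ord := ord_lt_ord.2 (hχ.trans hχlam)
  obtain ⟨C, hC, hcov⟩ := exists_club_family hκ hcof
  choose j hj using exists_enum (lam := lam)
  obtain ⟨o, ho⟩ := exists_rk_eq (hκ.ord_pos.trans hlamκ)
  have hA := isClosedUnbounded_closurePoints hκ hκ_unc hχlam.le hC j o
  have hbdd : ∀ {δ : Ordinal.{u}}, δ < lam.ord → ∀ {f : List lam.ord.ToType → Set lam.ord.ToType},
      (∀ l, #(f l) < κ) → (∀ l, f l ⊆ below δ) →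
      Captured χ (closurePoints hχlam.le C j o) f := fun hδ _ hf hfδ =>
    captured_of_bounded hκ hκ_unc hχ.le hcov hj
      (fun μ h h' => isRegular_or_cof_lt (hκ.1.trans hχ.le) h h') hδ hf hfδ
  have hlev : ∀ s : Set lam.ord.ToType, ∃ i : lam.ord.ToType, #s < κ →
      rk i < κ.ord ∧ s ⊆ below (succIter χ (rk i)).ord := fun s => by
    by_cases hs : #s < κ
    · obtain ⟨i, hi, hsi⟩ := exists_subset_below_succIter hκ hs
      obtain ⟨x, rfl⟩ := exists_rk_eq (hi.trans hlamκ)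
      exact ⟨x, fun _ => ⟨hi, hsi⟩⟩
    · exact ⟨o, fun h => (hs h).elim⟩
  choose lev hlev using hlev
  refine ⟨closurePoints hχlam.le C j o, ⟨_, hA, disjoint_compl_left⟩, ?_⟩
  refine Set.Subset.antisymm (fun B hB => ?_) fun B hB => NSmu_mono hχ.le hB
  refine mem_NSmu_of_captured (A := closurePoints hχlam.le C j o) hκ ho (fun a ha => ha.1) lev (fun s hs => (hlev s hs).1) ?_
    (fun f hf hfκ => hbdd hlamκ hf hfκ) Set.inter_subset_right
    (NSmu_subset_nonclosedIdeal hκ hκ_unc hB)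
  -- All values at level `i` lie below `χ^{+i} < lam`, so the bounded case applies.
  intro f hf i hi hfi
  refine hbdd (ord_lt_ord.2 (succIter_lt_succIter hi)) hf fun l => ?_
  rcases eq_or_ne (f l) ∅ with h | h
  · rw [h]
    exact Set.empty_subset _
  · rw [← hfi l h]
    exact (hlev _ (hf l)).2

end PkLambda

theorem corollary2p2 (κ χ : Cardinal.{u}) (hκ : κ.IsRegular) (hκ_unc : Cardinal.aleph0 < κ)
    (hχ : κ < χ)
    (hcof : PkLambda.cofBar (PkLambda.NS κ χ) ≤ PkLambda.succIter χ κ.ord) :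
    ∃ A ∈ PkLambda.dual (PkLambda.NS κ (PkLambda.succIter χ κ.ord)),
      PkLambda.restrict (PkLambda.NSmu κ (PkLambda.succIter χ κ.ord) χ) A =
        PkLambda.restrict (PkLambda.NSmu κ (PkLambda.succIter χ κ.ord) κ) A :=
  PkLambda.exists_restrict_NSmu_eq hκ hκ_unc hχ hcof
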